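/- Let $B_n$ denote the Bernoulli numbers, $\frac{z}{e^z-1}=\sum_{n\ge 0}B_n\frac{z^n}{n!}$, let $\varphi$ be Euler's function, and let $\operatorname{num}(x)$ be the numerator of a rational number $x$ in lowest terms; for an integer $d\geq 1$ that is a power of a prime, $d\mid x$ means $d\mid\operatorname{num}(x)$. For an odd prime $p$, a pair $(p,l)$ is an irregular pair if $l$ is even, $2\le l\le p-3$ and $p\mid B_l$. A pair $(p,l')$ is an irregular pair of order $n\ge1$ if $l'$ is even, $2\le l'<\varphi(p^n)$ and $p^n\mid B_{l'}/l'$; it corresponds to the irregular pair $(p,l)$ if $l'\equiv l \pmod{p-1}$. Its $p$-adic notation is the tuple $(p,s_1,\dots,s_n)$ with $l'=\sum_{\nu=1}^n s_\nu\,\varphi(p^{\nu-1})$, $0\le s_\nu<p$, $s_1$ even and $2\le s_1\le p-3$. For an irregular pair $(p,l)$ let $\Delta_{(p,l)}\in\{0,\dots,p-1\}$ be determined by $$\Delta_{(p,l)}\equiv p^{-1}\left(\frac{B_{l+\varphi(p)}}{l+\varphi(p)}-\frac{B_l}{l}\right)\pmod p .$$ Let $(p,l)$ be an irregular pair with $\Delta_{(p,l)}\ne0$,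 let $r\ge2$ be an integer, and let $(p,s_1,\dots,s_r)$ be the $p$-adic notation of an irregular pair of order $r$ corresponding to $(p,l)$. Assume that $(p,s_1,s_2,\dots,s_r)\neq(p,l,l-1,\dots,l-1)$. Then for every integer $u\ge r$ there is exactly one irregular pair $(p,l_u)$ of order $u$ corresponding to $(p,l)$, and $$A(p^u)=\min\left\{m=l_u+k\varphi(p^u),\ k\in\mathbb{Z}_{\ge0}\ \middle|\ \operatorname{num}\left(\frac{B_m}{m}\right)\Big/\operatorname{num}\left(\frac{B_m}{m(m-1)}\right)=p^u\right\}$$ has no solution, that is, the set on the right has no least element (it is empty). -/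

import Mathlib

/-- `(p, l)` is an irregular pair: `p` is an odd prime, `l` is even, `2 ≤ l ≤ p - 3`, and `p`
divides (the numerator of) the Bernoulli number `B_l`. -/
def IsIrregularPair (p l : ℕ) : Prop :=
  p.Prime ∧ p ≠ 2 ∧ Even l ∧ 2 ≤ l ∧ l + 3 ≤ p ∧ (p : ℤ) ∣ (bernoulli l).num

/-- The divided Bernoulli number `B_m / m`. -/
def dividedBernoulli (m : ℕ) : ℚ := bernoulli m / m

/-- The set of irregular pairs `(p, l)` of order `n`. -/
def PsiIrr (n : ℕ) : Set (ℕ × ℕ) :=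
  {x | x.1.Prime ∧ x.1 ≠ 2 ∧ ((x.1 : ℤ) ^ n ∣ (dividedBernoulli x.2).num) ∧
    2 ≤ x.2 ∧ x.2 < Nat.totient (x.1 ^ n) ∧ Even x.2}

/-- The integer `∑_{ν=1}^{n} s_ν φ(p^{ν-1})` with digits `(s_1, …, s_n)`; here the digit `s_ν` is
stored at the index `ν - 1`. -/
def digitValue (p : ℕ) {n : ℕ} (s : Fin n → ℕ) : ℕ :=
  ∑ i : Fin n, s i * Nat.totient (p ^ (i : ℕ))

/-- The set of irregular pairs `(p, s_1, …, s_n)` of order `n` in `p`-adic notation. -/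
def PsiHatIrr (n : ℕ) : Set (ℕ × (Fin n → ℕ)) :=
  {x | (x.1, digitValue x.1 x.2) ∈ PsiIrr n ∧ (∀ i, x.2 i < x.1) ∧
    ∀ i : Fin n, (i : ℕ) = 0 → Even (x.2 i) ∧ 2 ≤ x.2 i ∧ x.2 i + 3 ≤ x.1}

/-- `(p, l')` is an irregular pair of order `n` corresponding (related) to the irregular pair
`(p, l)`: its index `l'` lies in the residue class of `l` modulo `p - 1`. -/
def CorrespondsTo (p l n l' : ℕ) : Prop :=
  (p, l') ∈ PsiIrr n ∧ l' ≡ l [MOD p - 1]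

/-- `Δ_{(p,l)}`: the representative in `{0, …, p - 1}` of the residue class modulo `p` of the
`p`-integral rational number `p⁻¹ (B_{l+φ(p)}/(l+φ(p)) - B_l/l)`. -/
def irregularDelta (p l : ℕ) : ℕ :=
  let q : ℚ := (dividedBernoulli (l + Nat.totient p) - dividedBernoulli l) / p
  ((q.num : ZMod p) * (q.den : ZMod p)⁻¹).val

/-- The set of which `A(p^n)` is the minimum, where `(p, l')` is an irregular pair of order `n`:
all `m = l' + k φ(p^n)` with `num (B_m / m) / num (B_m / (m (m - 1))) = p^n`. -/
def solutionSet (p n l' : ℕ) : Set ℕ :=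
  {m | (∃ k : ℕ, m = l' + k * Nat.totient (p ^ n)) ∧
    ((bernoulli m / (m : ℚ)).num : ℚ) / ((bernoulli m / ((m : ℚ) * ((m : ℚ) - 1))).num : ℚ)
      = (p : ℚ) ^ n}

/-- The digits `(l, l - 1, …, l - 1)`. -/
def specialDigits (l n : ℕ) : Fin n → ℕ := fun i => if (i : ℕ) = 0 then l else l - 1

/-- The ring `ℤ_(p)` of `p`-integral rational numbers. -/
noncomputable def pIntegers (p : ℕ) [Fact p.Prime] : Subring ℚ :=
  (Rat.padicValuation p).integer

/-- `x ∈ p ^ n ℤ_(p)`. -/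
def PowDvd (p : ℕ) [Fact p.Prime] (n : ℕ) (x : ℚ) : Prop :=
  ∃ z ∈ pIntegers p, x = (p : ℚ) ^ n * z

section PIntegers

variable {p : ℕ} [Fact p.Prime]

theorem mem_pIntegers_iff {x : ℚ} : x ∈ pIntegers p ↔ ¬ p ∣ x.den := by
  rw [← Rat.padicValuation_le_one_iff]
  rfl

theorem inv_natCast_mem_pIntegers {m : ℕ} (hm : ¬ p ∣ m) : (m : ℚ)⁻¹ ∈ pIntegers p := by
  rw [mem_pIntegers_iff]
  rcases Nat.eq_zero_or_pos m with rfl | h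
  · simp at hm
  · rwa [Rat.inv_natCast_den_of_pos h]

theorem inv_intCast_mem_pIntegers {m : ℤ} (hm : ¬ (p : ℤ) ∣ m) : (m : ℚ)⁻¹ ∈ pIntegers p := by
  have h := inv_natCast_mem_pIntegers (p := p) (m := m.natAbs)
    (fun h => hm (Int.natCast_dvd.2 h))
  rcases Int.natAbs_eq m with e | e
  · rw [e]; simpa using h
  · rw [e]
    simpa [inv_neg] using neg_mem h

theorem pow_div_mem_pIntegers {j m : ℕ} (hm : m ≠ 0) (h : m < p ^ (j + 1)) :
    (p : ℚ) ^ j / m ∈ pIntegers p := by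
  have hp : p.Prime := Fact.out
  have hp0 : (p : ℚ) ≠ 0 := mod_cast hp.ne_zero
  obtain ⟨e, m', hm', rfl⟩ := Nat.exists_eq_pow_mul_and_not_dvd hm p hp.ne_one
  have hm'0 : m' ≠ 0 := by rintro rfl; simp at hm'
  have he : e ≤ j := by
    have : p ^ e < p ^ (j + 1) :=
      lt_of_le_of_lt (Nat.le_mul_of_pos_right _ (Nat.pos_of_ne_zero hm'0)) h
    have := (Nat.pow_lt_pow_iff_right hp.one_lt).1 this
    omega
  obtain ⟨d, rfl⟩ := Nat.exists_eq_add_of_le he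
  have : (p : ℚ) ^ (e + d) / ((p ^ e * m' : ℕ) : ℚ) = ((p ^ d : ℕ) : ℚ) * (m' : ℚ)⁻¹ := by
    have : (m' : ℚ) ≠ 0 := mod_cast hm'0
    push_cast
    field_simp
    ring
  rw [this]
  exact mul_mem (natCast_mem _ _) (inv_natCast_mem_pIntegers hm')

namespace PowDvd

variable {n : ℕ} {x y : ℚ}

theorem add (hx : PowDvd p n x) (hy : PowDvd p n y) : PowDvd p n (x + y) := by
  obtain ⟨z, hz, rfl⟩ := hx
  obtain ⟨w, hw, rfl⟩ := hy
  exact ⟨z + w, add_mem hz hw, by ring⟩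

theorem neg (hx : PowDvd p n x) : PowDvd p n (-x) := by
  obtain ⟨z, hz, rfl⟩ := hx
  exact ⟨-z, neg_mem hz, by ring⟩

theorem sub (hx : PowDvd p n x) (hy : PowDvd p n y) : PowDvd p n (x - y) := by
  rw [sub_eq_add_neg]
  exact hx.add hy.neg

theorem sum {ι : Type*} {s : Finset ι} {f : ι → ℚ} (h : ∀ i ∈ s, PowDvd p n (f i)) :
    PowDvd p n (∑ i ∈ s, f i) := by
  classical
  induction s using Finset.induction_on with
  | empty => exact ⟨0, zero_mem _, by simp⟩
  | insert a s ha ih =>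
    rw [Finset.sum_insert ha]
    exact (h a (Finset.mem_insert_self _ _)).add
      (ih fun i hi => h i (Finset.mem_insert_of_mem hi))

theorem mul_left (hy : y ∈ pIntegers p) (hx : PowDvd p n x) : PowDvd p n (y * x) := by
  obtain ⟨z, hz, rfl⟩ := hx
  exact ⟨y * z, mul_mem hy hz, by ring⟩

theorem mono {k : ℕ} (h : k ≤ n) (hx : PowDvd p n x) : PowDvd p k x := by
  obtain ⟨z, hz, rfl⟩ := hx
  obtain ⟨d, rfl⟩ := Nat.exists_eq_add_of_le h
  exact ⟨((p ^ d : ℕ) : ℚ) * z, mul_mem (natCast_mem _ _) hz, by push_cast; ring⟩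

theorem intCast_mul_iff {c : ℤ} (hc : ¬ (p : ℤ) ∣ c) :
    PowDvd p n ((c : ℚ) * x) ↔ PowDvd p n x := by
  refine ⟨fun h => ?_, fun h => h.mul_left (intCast_mem _ _)⟩
  have hc0 : (c : ℚ) ≠ 0 := by
    rintro h0
    exact hc (by simp [Int.cast_eq_zero.1 h0])
  have := h.mul_left (inv_intCast_mem_pIntegers hc)
  rwa [inv_mul_cancel_left₀ hc0] at this

theorem congr (h : PowDvd p n (x - y)) : PowDvd p n x ↔ PowDvd p n y := by
  refine ⟨fun hx => ?_, fun hy => ?_⟩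
  · simpa using hx.sub h
  · simpa using h.add hy

end PowDvd

theorem powDvd_iff_dvd_num {n : ℕ} (hn : n ≠ 0) {x : ℚ} :
    PowDvd p n x ↔ (p : ℤ) ^ n ∣ x.num := by
  have hp : p.Prime := Fact.out
  constructor
  · rintro ⟨z, hz, hx⟩
    rw [mem_pIntegers_iff] at hz
    have h1 : x.num * (z.den : ℤ) = (p : ℤ) ^ n * (z.num * x.den) := by
      have hxd : (x.den : ℚ) ≠ 0 := mod_cast x.den_ne_zero
      have hzd : (z.den : ℚ) ≠ 0 := mod_cast z.den_ne_zero
      rw [← Rat.num_div_den x, ← Rat.num_div_den z] at hx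
      field_simp at hx
      have h2 : (x.num : ℚ) * z.den = p ^ n * (z.num * x.den) := by rw [hx]; ring
      exact_mod_cast h2
    have hcop : IsCoprime ((p : ℤ) ^ n) (z.den : ℤ) := by
      refine IsCoprime.pow_left ?_
      exact Nat.isCoprime_iff_coprime.2 ((Nat.Prime.coprime_iff_not_dvd hp).2 hz)
    exact hcop.dvd_of_dvd_mul_right (Dvd.intro _ h1.symm)
  · rintro ⟨k, hk⟩
    have hden : ¬ p ∣ x.den := fun h => by
      have h1 : p ∣ x.num.natAbs := by
        rw [← Int.natCast_dvd, hk]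
        exact (dvd_pow_self _ hn).mul_right _
      have := Nat.dvd_gcd h1 h
      rw [x.reduced] at this
      exact hp.one_lt.ne' (Nat.dvd_one.1 this)
    refine ⟨k * (x.den : ℚ)⁻¹, mul_mem (intCast_mem _ _) (inv_natCast_mem_pIntegers hden), ?_⟩
    conv_lhs => rw [← Rat.num_div_den x, hk]
    push_cast
    ring

theorem powDvd_intCast_iff {n : ℕ} {x : ℤ} : PowDvd p n (x : ℚ) ↔ (p : ℤ) ^ n ∣ x := by
  rcases eq_or_ne n 0 with rfl | hn
  · simpa using ⟨(x : ℚ), intCast_mem _ _, by simp⟩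
  · rw [powDvd_iff_dvd_num hn, Rat.num_intCast]

/-- Binomial expansion to second order, with a remainder that keeps the factor `m`. -/
theorem add_pow_mul_pow_eq (hp5 : 5 ≤ p) {N : ℕ} (hN : 1 ≤ N) (y z : ℤ) (m : ℕ) :
    ∃ w ∈ pIntegers p, ((y : ℚ) + p ^ N * z) ^ m =
      (y : ℚ) ^ m + m * p ^ N * z * y ^ (m - 1) + m * (p ^ N) ^ 2 * w := by
  rcases m with _ | _ | k
  · exact ⟨0, zero_mem _, by simp⟩
  · exact ⟨0, zero_mem _, by simp⟩
  refine ⟨∑ j ∈ Finset.range (k + 1), (z : ℚ) ^ (j + 2) * y ^ (k - j) * ((k + 1).choose (j + 1))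
    * ((p : ℚ) ^ (N * j) / ((j + 2 : ℕ) : ℚ)), ?_, ?_⟩
  · refine sum_mem fun j _ => mul_mem (mul_mem (mul_mem (pow_mem (intCast_mem _ _) _)
      (pow_mem (intCast_mem _ _) _)) (natCast_mem _ _)) ?_
    refine pow_div_mem_pIntegers (by omega) ?_
    have h1 : j + 2 < p ^ (j + 1) := by
      have : j + 1 < 2 ^ (j + 1) := Nat.lt_two_pow_self
      calc j + 2 ≤ 2 ^ (j + 1) := by omega
        _ < p ^ (j + 1) := Nat.pow_lt_pow_left (by omega) (by omega)
    exact h1.trans_le (Nat.pow_le_pow_right (by omega) (by nlinarith))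
  · rw [add_comm (y : ℚ), add_pow, Finset.sum_range_succ', Finset.sum_range_succ', Finset.mul_sum]
    have : ∀ j ∈ Finset.range (k + 1),
        ((p : ℚ) ^ N * z) ^ (j + 1 + 1) * y ^ (k + 1 + 1 - (j + 1 + 1)) *
          ((k + 1 + 1).choose (j + 1 + 1) : ℕ) =
        ((k + 1 + 1 : ℕ) : ℚ) * (p ^ N) ^ 2 * ((z : ℚ) ^ (j + 2) * y ^ (k - j) *
          ((k + 1).choose (j + 1)) * ((p : ℚ) ^ (N * j) / ((j + 2 : ℕ) : ℚ))) := by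
      intro j _
      have hc : ((k + 1 + 1).choose (j + 1 + 1) : ℚ) =
          ((k + 1 + 1 : ℕ) : ℚ) * ((k + 1).choose (j + 1)) / ((j + 2 : ℕ) : ℚ) := by
        rw [eq_div_iff (by positivity)]
        have := Nat.add_one_mul_choose_eq (k + 1) (j + 1)
        exact_mod_cast this.symm
      rw [hc, show k + 1 + 1 - (j + 1 + 1) = k - j by omega]
      ring
    rw [Finset.sum_congr rfl this]
    simp
    ring

end PIntegers

section BernoulliCongruences

variable {p : ℕ} [Fact p.Prime]

theorem prime_mul_bernoulli_mem_pIntegers (m : ℕ) : (p : ℚ) * bernoulli m ∈ pIntegers p := by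
  have hp : p.Prime := Fact.out
  induction m using Nat.strong_induction_on with
  | _ m ih =>
  have h := sum_range_pow p m
  rw [Finset.sum_range_succ] at h
  have hlast : bernoulli m * ((m + 1).choose m : ℕ) * (p : ℚ) ^ (m + 1 - m) / (m + 1) =
      p * bernoulli m := by
    have : (m : ℚ) + 1 ≠ 0 := by positivity
    rw [Nat.choose_succ_self_right, Nat.add_sub_cancel_left]
    push_cast
    field_simp
  rw [hlast] at h
  rw [← sub_eq_iff_eq_add'.2 h]
  refine sub_mem (sum_mem fun x _ => pow_mem (natCast_mem _ _) _) (sum_mem fun i hi => ?_)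
  have him : i < m := Finset.mem_range.1 hi
  obtain ⟨j, rfl⟩ := Nat.exists_eq_add_of_le him.le
  have hc : ((i + j + 1).choose i : ℚ) =
      ((i + j).choose i) * ((i + j + 1 : ℕ) : ℚ) / ((j + 1 : ℕ) : ℚ) := by
    rw [eq_div_iff (by positivity)]
    have := Nat.choose_mul_succ_eq (i + j) i
    rw [show i + j + 1 - i = j + 1 by omega] at this
    exact_mod_cast this.symm
  have he : bernoulli i * ((i + j + 1).choose i) * (p : ℚ) ^ (i + j + 1 - i) /
      ((i + j : ℕ) + 1) = (p * bernoulli i) * ((i + j).choose i) *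
        ((p : ℚ) ^ j / ((j + 1 : ℕ) : ℚ)) := by
    rw [hc, show i + j + 1 - i = j + 1 by omega]
    have : ((i : ℚ) + j + 1) ≠ 0 := by positivity
    push_cast
    field_simp
    ring
  rw [he]
  exact mul_mem (mul_mem (ih i him) (natCast_mem _ _))
    (pow_div_mem_pIntegers (by omega) (Nat.lt_pow_self hp.one_lt))

theorem bernoulli_pred_mem_pIntegers (hp5 : 5 ≤ p) {m : ℕ} (hm : Even m) (hm2 : 2 ≤ m) :
    bernoulli (m - 1) ∈ pIntegers p := by
  rcases eq_or_ne m 2 with rfl | h2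
  · have h := inv_natCast_mem_pIntegers (p := p) (m := 2)
      (fun h => by have := Nat.le_of_dvd (by norm_num) h; omega)
    have := neg_mem h
    norm_num [bernoulli_one] at this ⊢
    exact this
  · rw [bernoulli_eq_zero_of_odd (Nat.Even.sub_odd (by omega) hm odd_one) (by
      obtain ⟨k, rfl⟩ := hm; omega)]
    exact zero_mem _

/-- The power sums over a complete residue system modulo `p ^ N` approximate `B_m / m`. -/
theorem powDvd_sum_pow_div_sub_dividedBernoulli (hp5 : 5 ≤ p) {N m : ℕ} (hN : 1 ≤ N)
    (hm : Even m) (hm2 : 2 ≤ m) :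
    PowDvd p N ((∑ x ∈ Finset.range (p ^ N), (x : ℚ) ^ m) / (m * (p : ℚ) ^ N) -
      dividedBernoulli m) := by
  have hp : p.Prime := Fact.out
  have hp0 : (p : ℚ) ≠ 0 := mod_cast hp.ne_zero
  have hm0 : (m : ℚ) ≠ 0 := mod_cast (by omega : m ≠ 0)
  have h := sum_range_pow (p ^ N) m
  rw [Finset.sum_range_succ] at h
  have hlast : bernoulli m * ((m + 1).choose m : ℕ) * ((p ^ N : ℕ) : ℚ) ^ (m + 1 - m) / (m + 1) =
      dividedBernoulli m * (m * (p : ℚ) ^ N) := by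
    have : (m : ℚ) + 1 ≠ 0 := by positivity
    rw [Nat.choose_succ_self_right, Nat.add_sub_cancel_left, dividedBernoulli]
    push_cast
    field_simp
  rw [hlast] at h
  rw [h, add_div, mul_div_cancel_right₀ _ (by positivity), add_sub_cancel_right, Finset.sum_div]
  refine PowDvd.sum fun i hi => ?_
  have him : i < m := Finset.mem_range.1 hi
  obtain ⟨j, rfl⟩ := Nat.exists_eq_add_of_le him
  have hc : ((i + 1 + j + 1).choose i : ℚ) =
      ((i + j).choose i) * ((i + 1 + j : ℕ) : ℚ) * ((i + j + 2 : ℕ) : ℚ) /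
        (((j + 1 : ℕ) : ℚ) * ((j + 2 : ℕ) : ℚ)) := by
    rw [eq_div_iff (by positivity)]
    have h1 := Nat.choose_mul_succ_eq (i + j) i
    have h2 := Nat.choose_mul_succ_eq (i + 1 + j) i
    rw [show i + j + 1 - i = j + 1 by omega] at h1
    rw [show i + 1 + j + 1 - i = j + 2 by omega] at h2
    rw [show i + j + 1 = i + 1 + j by omega] at h1
    have h3 : (i + 1 + j + 1).choose i * ((j + 1) * (j + 2)) =
        (i + j).choose i * (i + 1 + j) * (i + j + 2) := by
      rw [h1, show i + j + 2 = i + 1 + j + 1 by omega]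
      calc _ = (i + 1 + j + 1).choose i * (j + 2) * (j + 1) := by ring
        _ = _ := by rw [← h2]; ring
    exact_mod_cast h3
  have he : bernoulli i * ((i + 1 + j + 1).choose i) * ((p ^ N : ℕ) : ℚ) ^ (i + 1 + j + 1 - i) /
      ((i + 1 + j : ℕ) + 1) / ((i + 1 + j : ℕ) * (p : ℚ) ^ N) =
      (p : ℚ) ^ N * (bernoulli i * ((i + j).choose i) *
        ((p : ℚ) ^ (N * j) / (((j + 1 : ℕ) : ℚ) * ((j + 2 : ℕ) : ℚ)))) := by
    rw [hc, show i + 1 + j + 1 - i = j + 2 by omega]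
    have : ((i : ℚ) + j + 2) ≠ 0 := by positivity
    have : ((i : ℚ) + 1 + j) ≠ 0 := by positivity
    have : ((i : ℚ) + 1 + j + 1) ≠ 0 := by positivity
    push_cast
    field_simp
    ring
  rw [he]
  refine ⟨_, ?_, rfl⟩
  rcases j with _ | j
  · have h2 := inv_natCast_mem_pIntegers (p := p) (m := 2)
      (fun h => by have := Nat.le_of_dvd (by norm_num) h; omega)
    have hB := bernoulli_pred_mem_pIntegers hp5 hm hm2
    rw [show i + 1 + 0 - 1 = i by omega] at hB
    have := mul_mem (mul_mem hB (natCast_mem _ ((i + 0).choose i))) h2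
    simpa using this
  · have hsplit : bernoulli i * ((i + (j + 1)).choose i) *
        ((p : ℚ) ^ (N * (j + 1)) / (((j + 1 + 1 : ℕ) : ℚ) * ((j + 1 + 2 : ℕ) : ℚ))) =
        (p * bernoulli i) * ((i + (j + 1)).choose i) * ((p ^ ((N - 1) * (j + 1)) : ℕ) : ℚ) *
          ((p : ℚ) ^ j / ((j + 2 : ℕ) : ℚ) - (p : ℚ) ^ j / ((j + 3 : ℕ) : ℚ)) := by
      obtain ⟨N, rfl⟩ := Nat.exists_eq_add_of_le' hN
      have h2 : ((j : ℚ) + 2) ≠ 0 := by positivity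
      have h3 : ((j : ℚ) + 3) ≠ 0 := by positivity
      have h2' : ((j : ℚ) + 1 + 1) ≠ 0 := by positivity
      have h3' : ((j : ℚ) + 1 + 2) ≠ 0 := by positivity
      rw [Nat.add_sub_cancel]
      push_cast
      field_simp
      ring
    rw [hsplit]
    have hlt : j + 3 < p ^ (j + 1) := by
      have h1 : j + 1 ≤ 2 ^ j := Nat.lt_two_pow_self
      have h2 : 2 ^ j ≤ p ^ j := Nat.pow_le_pow_left (by omega) _
      rw [pow_succ]
      nlinarith
    exact mul_mem (mul_mem (mul_mem (prime_mul_bernoulli_mem_pIntegers i) (natCast_mem _ _))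
      (natCast_mem _ _)) (sub_mem (pow_div_mem_pIntegers (by omega) (by omega))
        (pow_div_mem_pIntegers (by omega) hlt))

theorem sum_range_mul_mod_pow {M a : ℕ} (ha : a.Coprime M) (m : ℕ) :
    ∑ x ∈ Finset.range M, ((a * x % M : ℕ) : ℚ) ^ m = ∑ x ∈ Finset.range M, (x : ℚ) ^ m := by
  rcases Nat.eq_zero_or_pos M with rfl | hM
  · simp
  have hmaps : Set.MapsTo (fun x => a * x % M) (Finset.range M) (Finset.range M) := by
    intro x _
    simpa using Nat.mod_lt _ hM
  have hinj : Set.InjOn (fun x => a * x % M) (Finset.range M) := by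
    intro x hx y hy hxy
    have h1 : x ≡ y [MOD M] := Nat.ModEq.cancel_left_of_coprime ha.symm hxy
    exact h1.eq_of_lt_of_lt (by simpa using hx) (by simpa using hy)
  exact Finset.sum_nbij (fun x => a * x % M) hmaps hinj
    (Finset.surjOn_of_injOn_of_card_le _ hmaps hinj le_rfl) (fun _ _ => rfl)

/-- **Voronoi's congruence** modulo a prime power. -/
theorem powDvd_voronoi (hp5 : 5 ≤ p) {N m a : ℕ} (hN : 1 ≤ N) (hm : Even m) (hm2 : 2 ≤ m)
    (ha : a.Coprime p) :
    PowDvd p N (((a : ℚ) ^ m - 1) * dividedBernoulli m -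
      ∑ x ∈ Finset.range (p ^ N), ((a * x : ℕ) : ℚ) ^ (m - 1) * ((a * x / p ^ N : ℕ) : ℚ)) := by
  have hp : p.Prime := Fact.out
  have hp0 : (p : ℚ) ≠ 0 := mod_cast hp.ne_zero
  have hm0 : (m : ℚ) ≠ 0 := mod_cast (by omega : m ≠ 0)
  have key : ∀ x : ℕ, ∃ w ∈ pIntegers p, ((a * x % p ^ N : ℕ) : ℚ) ^ m =
      ((a * x : ℕ) : ℚ) ^ m - m * p ^ N * (((a * x : ℕ) : ℚ) ^ (m - 1) *
        ((a * x / p ^ N : ℕ) : ℚ)) + m * (p ^ N) ^ 2 * w := by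
    intro x
    obtain ⟨w, hw, h⟩ := add_pow_mul_pow_eq hp5 hN ((a * x : ℕ) : ℤ) (-((a * x / p ^ N : ℕ) : ℤ)) m
    refine ⟨w, hw, ?_⟩
    have hdm : ((a * x : ℕ) : ℚ) =
        p ^ N * ((a * x / p ^ N : ℕ) : ℚ) + ((a * x % p ^ N : ℕ) : ℚ) := by
      exact_mod_cast (Nat.div_add_mod (a * x) (p ^ N)).symm
    have hr : ((a * x % p ^ N : ℕ) : ℚ) = (((a * x : ℕ) : ℤ) : ℚ) +
        p ^ N * ((-((a * x / p ^ N : ℕ) : ℤ) : ℤ) : ℚ) := by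
      rw [Int.cast_neg, Int.cast_natCast, Int.cast_natCast, hdm]
      ring
    rw [hr, h, Int.cast_neg, Int.cast_natCast, Int.cast_natCast]
    ring
  choose w hw hkey using key
  have hsum := sum_range_mul_mod_pow (ha.pow_right N) m
  simp only [hkey] at hsum
  rw [Finset.sum_add_distrib, Finset.sum_sub_distrib, ← Finset.mul_sum, ← Finset.mul_sum] at hsum
  simp only [Nat.cast_mul a, mul_pow (a : ℚ)] at hsum ⊢
  rw [← Finset.mul_sum] at hsum
  set S := ∑ x ∈ Finset.range (p ^ N), (x : ℚ) ^ m with hS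
  obtain ⟨z, hz, hzS⟩ := powDvd_sum_pow_div_sub_dividedBernoulli hp5 hN hm hm2
  rw [← hS] at hzS
  refine ⟨-(∑ x ∈ Finset.range (p ^ N), w x) - (a ^ m - 1) * z,
    sub_mem (neg_mem (sum_mem fun x _ => hw x))
      (mul_mem (sub_mem (pow_mem (natCast_mem _ _) _) (one_mem _)) hz), ?_⟩
  have hB : dividedBernoulli m = S / (m * (p : ℚ) ^ N) - p ^ N * z := by rw [← hzS]; ring
  rw [hB]
  have hP : (p : ℚ) ^ N ≠ 0 := pow_ne_zero _ hp0
  refine mul_left_cancel₀ (mul_ne_zero hm0 hP) ?_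
  rw [mul_sub, mul_comm ((m : ℚ) * p ^ N), mul_assoc, sub_mul (S / _),
    div_mul_cancel₀ _ (mul_ne_zero hm0 hP)]
  linear_combination hsum

/-- Voronoi's congruence with the Euler factor at `p` removed. -/
theorem powDvd_voronoi_eulerFactor (hp5 : 5 ≤ p) {N m a : ℕ} (hN : 2 ≤ N) (hm : Even m)
    (hm2 : 2 ≤ m) (ha : a.Coprime p) :
    PowDvd p N ((1 - (p : ℚ) ^ (m - 1)) * (((a : ℚ) ^ m - 1) * dividedBernoulli m) -
      ∑ x ∈ (Finset.range (p ^ N)).filter (fun x => ¬ p ∣ x),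
        ((a * x : ℕ) : ℚ) ^ (m - 1) * ((a * x / p ^ N : ℕ) : ℚ)) := by
  have hp : p.Prime := Fact.out
  obtain ⟨N, rfl⟩ := Nat.exists_eq_add_of_le' (by omega : 1 ≤ N)
  have hsplit := Finset.sum_filter_add_sum_filter_not (Finset.range (p ^ (N + 1)))
    (fun x => p ∣ x)
    (fun x => ((a * x : ℕ) : ℚ) ^ (m - 1) * ((a * x / p ^ (N + 1) : ℕ) : ℚ))
  have hmult : ∑ x ∈ (Finset.range (p ^ (N + 1))).filter (fun x => p ∣ x),
      ((a * x : ℕ) : ℚ) ^ (m - 1) * ((a * x / p ^ (N + 1) : ℕ) : ℚ) =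
      (p : ℚ) ^ (m - 1) * ∑ y ∈ Finset.range (p ^ N),
        ((a * y : ℕ) : ℚ) ^ (m - 1) * ((a * y / p ^ N : ℕ) : ℚ) := by
    rw [Finset.mul_sum]
    symm
    refine Finset.sum_nbij (fun y => p * y) ?_ ?_ ?_ ?_
    · intro y hy
      simp only [Finset.mem_filter, Finset.mem_range] at hy ⊢
      refine ⟨?_, dvd_mul_right _ _⟩
      rw [pow_succ']
      exact Nat.mul_lt_mul_of_pos_left hy hp.pos
    · intro x _ y _ hxy
      exact Nat.eq_of_mul_eq_mul_left hp.pos hxy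
    · intro x hx
      simp only [Finset.coe_filter, Finset.mem_range, Set.mem_ofPred_eq] at hx
      obtain ⟨hx, y, rfl⟩ := hx
      refine ⟨y, ?_, rfl⟩
      rw [pow_succ'] at hx
      simpa using lt_of_mul_lt_mul_left hx (Nat.zero_le _)
    · intro y _
      have : a * (p * y) / p ^ (N + 1) = a * y / p ^ N := by
        rw [pow_succ', mul_left_comm, Nat.mul_div_mul_left _ _ hp.pos]
      rw [this]
      push_cast
      ring
  rw [hmult] at hsplit
  have h1 := powDvd_voronoi hp5 (show 1 ≤ N + 1 by omega) hm hm2 ha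
  obtain ⟨z, hz, h2⟩ := powDvd_voronoi hp5 (show 1 ≤ N by omega) hm hm2 ha
  have h3 : PowDvd p (N + 1) ((p : ℚ) ^ (m - 1) * (p ^ N * z)) := by
    refine ⟨((p ^ (m - 2) : ℕ) : ℚ) * z, mul_mem (natCast_mem _ _) hz, ?_⟩
    obtain ⟨k, rfl⟩ := Nat.exists_eq_add_of_le' hm2
    simp only [Nat.add_sub_cancel, show k + 2 - 1 = k + 1 by omega]
    push_cast
    ring
  convert h1.sub h3 using 1
  rw [← h2]
  linear_combination -hsplit

end BernoulliCongruences

section KummerCongruences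

variable {p : ℕ} [Fact p.Prime]

/-- The integral side of Voronoi's congruence with the Euler factor at `p` removed. -/
def voronoiSum (p N a m : ℕ) : ℤ :=
  ∑ x ∈ (Finset.range (p ^ N)).filter (fun x => ¬ p ∣ x),
    ((a * x : ℕ) : ℤ) ^ (m - 1) * ((a * x / p ^ N : ℕ) : ℤ)

theorem powDvd_sub_voronoiSum (hp5 : 5 ≤ p) {N m a : ℕ} (hN : 2 ≤ N) (hm : Even m)
    (hm2 : 2 ≤ m) (ha : a.Coprime p) :
    PowDvd p N ((1 - (p : ℚ) ^ (m - 1)) * (((a : ℚ) ^ m - 1) * dividedBernoulli m) -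
      (voronoiSum p N a m : ℚ)) := by
  convert powDvd_voronoi_eulerFactor hp5 hN hm hm2 ha using 2
  rw [voronoiSum, Int.cast_sum]
  refine Finset.sum_congr rfl fun x _ => ?_
  rw [Int.cast_mul, Int.cast_pow, Int.cast_natCast, Int.cast_natCast]

theorem pow_dvd_num_dividedBernoulli_iff (hp5 : 5 ≤ p) {N n m a : ℕ} (hN : 2 ≤ N) (hn : n ≠ 0)
    (hnN : n ≤ N) (hm : Even m) (hm2 : 2 ≤ m) (ha : a.Coprime p)
    (ham : ¬ (p : ℤ) ∣ (a : ℤ) ^ m - 1) :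
    (p : ℤ) ^ n ∣ (dividedBernoulli m).num ↔ (p : ℤ) ^ n ∣ voronoiSum p N a m := by
  have hp : p.Prime := Fact.out
  have hE : ¬ (p : ℤ) ∣ 1 - (p : ℤ) ^ (m - 1) := fun h => by
    have h1 := dvd_add h (dvd_pow_self (p : ℤ) (show m - 1 ≠ 0 by omega))
    rw [sub_add_cancel] at h1
    exact hp.one_lt.ne' (by exact_mod_cast Int.eq_one_of_dvd_one (by positivity) h1)
  have h := (powDvd_sub_voronoiSum hp5 hN hm hm2 ha).mono hnN
  have h1 := PowDvd.intCast_mul_iff (p := p) (n := n) (x := ((a : ℚ) ^ m - 1) * dividedBernoulli m) hE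
  have h2 := PowDvd.intCast_mul_iff (p := p) (n := n) (x := dividedBernoulli m) ham
  push_cast at h1 h2
  rw [← powDvd_iff_dvd_num hn, ← powDvd_intCast_iff, ← h.congr, h1, h2]

/-- First-order expansion of `t ↦ y ^ (e + t (p - 1))` in the `p`-adic variable `t`. -/
theorem exists_pow_add_mul_sub_one_expansion (hp5 : 5 ≤ p) {y : ℤ} (hy : ¬ (p : ℤ) ∣ y) (e : ℕ) :
    ∃ c : ℤ, ∀ n t k : ℕ, (p : ℤ) ^ (n + 2) ∣
      y ^ (e + (t + p ^ n * k) * (p - 1)) - y ^ (e + t * (p - 1)) - p ^ (n + 1) * k * c := by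
  have hp : p.Prime := Fact.out
  have hfermat : y ^ (p - 1) ≡ 1 [ZMOD p] :=
    Int.ModEq.pow_card_sub_one_eq_one hp
      ((Nat.prime_iff_prime_int.1 hp).coprime_iff_not_dvd.2 hy).symm
  obtain ⟨q, hq⟩ := hfermat.symm.dvd
  have hq' : y ^ (p - 1) = 1 + p * q := by linarith
  refine ⟨y ^ e * q, fun n t k => ?_⟩
  have hsplit : y ^ (e + (t + p ^ n * k) * (p - 1)) =
      y ^ e * (1 + p * q) ^ t * (1 + p * q) ^ (p ^ n * k) := by
    rw [← hq']
    ring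
  have hsplit0 : y ^ (e + t * (p - 1)) = y ^ e * (1 + p * q) ^ t := by
    rw [← hq']
    ring
  have h1 : (p : ℤ) ^ (n + 2) ∣ (1 + p * q) ^ (p ^ n * k) - 1 - p ^ (n + 1) * k * q := by
    rw [← powDvd_intCast_iff]
    obtain ⟨w, hw, h⟩ := add_pow_mul_pow_eq hp5 (le_refl 1) 1 q (p ^ n * k)
    refine ⟨k * w, mul_mem (natCast_mem _ _) hw, ?_⟩
    push_cast at h ⊢
    rw [pow_one] at h
    rw [h]
    ring
  have h2 : (p : ℤ) ∣ (1 + p * q) ^ t - 1 := by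
    have := sub_dvd_pow_sub_pow (1 + (p : ℤ) * q) 1 t
    rw [one_pow, add_sub_cancel_left] at this
    exact (dvd_mul_right _ _).trans this
  obtain ⟨v, hv⟩ := h1
  obtain ⟨w, hw⟩ := h2
  refine ⟨y ^ e * (1 + p * q) ^ t * v + y ^ e * w * k * q, ?_⟩
  rw [hsplit, hsplit0]
  linear_combination (y ^ e * (1 + p * q) ^ t) * hv + y ^ e * p ^ (n + 1) * k * q * hw

theorem exists_voronoiSum_expansion (hp5 : 5 ≤ p) (N : ℕ) {a l : ℕ} (ha : a.Coprime p)
    (hl : 1 ≤ l) :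
    ∃ c : ℤ, ∀ n t k : ℕ, (p : ℤ) ^ (n + 2) ∣
      voronoiSum p N a (l + (t + p ^ n * k) * (p - 1)) - voronoiSum p N a (l + t * (p - 1)) -
        p ^ (n + 1) * k * c := by
  have hp : p.Prime := Fact.out
  have hy : ∀ x : ℕ, ∃ c : ℤ, ¬ p ∣ x → ∀ n t k : ℕ, (p : ℤ) ^ (n + 2) ∣
      ((a * x : ℕ) : ℤ) ^ (l - 1 + (t + p ^ n * k) * (p - 1)) -
        ((a * x : ℕ) : ℤ) ^ (l - 1 + t * (p - 1)) - p ^ (n + 1) * k * c := by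
    intro x
    by_cases hx : p ∣ x
    · exact ⟨0, fun h => absurd hx h⟩
    · have : ¬ (p : ℤ) ∣ ((a * x : ℕ) : ℤ) := by
        rw [Int.natCast_dvd_natCast]
        exact fun h => hx ((ha.symm).dvd_of_dvd_mul_left h)
      obtain ⟨c, hc⟩ := exists_pow_add_mul_sub_one_expansion hp5 this (l - 1)
      exact ⟨c, fun _ => hc⟩
  choose c hc using hy
  refine ⟨∑ x ∈ (Finset.range (p ^ N)).filter (fun x => ¬ p ∣ x),
    c x * ((a * x / p ^ N : ℕ) : ℤ), fun n t k => ?_⟩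
  rw [voronoiSum, voronoiSum, Finset.mul_sum, ← Finset.sum_sub_distrib, ← Finset.sum_sub_distrib]
  refine Finset.dvd_sum fun x hx => ?_
  have h := (hc x (Finset.mem_filter.1 hx).2 n t k).mul_right ((a * x / p ^ N : ℕ) : ℤ)
  rw [Nat.sub_add_comm hl, Nat.sub_add_comm hl]
  convert h using 1
  ring

theorem pow_dvd_mod_of_expansion {p : ℕ} {f : ℕ → ℤ} {c : ℤ}
    (hf : ∀ n t k : ℕ, (p : ℤ) ^ (n + 2) ∣ f (t + p ^ n * k) - f t - p ^ (n + 1) * k * c)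
    {n t : ℕ} (ht : (p : ℤ) ^ (n + 1) ∣ f t) : (p : ℤ) ^ (n + 1) ∣ f (t % p ^ n) := by
  have h1 := hf n (t % p ^ n) (t / p ^ n)
  rw [Nat.mod_add_div] at h1
  have h2 : f (t % p ^ n) = f t - (f t - f (t % p ^ n) - p ^ (n + 1) * ↑(t / p ^ n) * c) -
      p ^ (n + 1) * (↑(t / p ^ n) * c) := by ring
  rw [h2]
  exact dvd_sub (dvd_sub ht ((pow_dvd_pow _ (by omega)).trans h1)) (dvd_mul_right _ _)

/-- Unique lifting of zeros for a function with invertible constant `p`-adic slope. -/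
theorem existsUnique_pow_dvd_of_expansion {f : ℕ → ℤ} {c : ℤ}
    (hf : ∀ n t k : ℕ, (p : ℤ) ^ (n + 2) ∣ f (t + p ^ n * k) - f t - p ^ (n + 1) * k * c)
    (hc : ¬ (p : ℤ) ∣ c) (h0 : (p : ℤ) ∣ f 0) (n : ℕ) :
    ∃! t : ℕ, t < p ^ n ∧ (p : ℤ) ^ (n + 1) ∣ f t := by
  have hp : p.Prime := Fact.out
  have hp0 : (p : ℤ) ≠ 0 := mod_cast hp.ne_zero
  induction n with
  | zero =>
    refine ⟨0, ⟨by simp, by simpa using h0⟩, fun t ht => by simpa using ht.1⟩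
  | succ n ih =>
    obtain ⟨t₀, ⟨ht₀, b, hb⟩, huniq⟩ := ih
    have hstep : ∀ k : ℕ, (p : ℤ) ^ (n + 2) ∣ f (t₀ + p ^ n * k) ↔ (p : ℤ) ∣ b + k * c := by
      intro k
      have h1 : (p : ℤ) ^ (n + 1) * (b + k * c) =
          f (t₀ + p ^ n * k) - (f (t₀ + p ^ n * k) - f t₀ - p ^ (n + 1) * k * c) := by
        rw [hb]; ring
      rw [← mul_dvd_mul_iff_left (b := (p : ℤ)) (pow_ne_zero (n + 1) hp0), ← pow_succ, h1,
        dvd_sub_left (hf n t₀ k)]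
    have hcop : IsCoprime c (p : ℤ) :=
      ((Nat.prime_iff_prime_int.1 hp).coprime_iff_not_dvd.2 hc).symm
    obtain ⟨u, v, huv⟩ := hcop
    have hk : ∃ k : ℕ, k < p ∧ (p : ℤ) ∣ b + k * c := by
      refine ⟨((-b * u) % p).toNat, ?_, ?_⟩
      · have := Int.emod_lt_of_pos (-b * u) (by positivity [hp.pos] : (0 : ℤ) < p)
        have := Int.emod_nonneg (-b * u) hp0
        omega
      · rw [Int.toNat_of_nonneg (Int.emod_nonneg _ hp0)]
        have := Int.emod_add_mul_ediv (-b * u) p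
        refine ⟨b * v - (-b * u / p) * c, ?_⟩
        linear_combination c * this - b * huv
    obtain ⟨k, hkp, hk⟩ := hk
    refine ⟨t₀ + p ^ n * k, ⟨?_, (hstep k).2 hk⟩, ?_⟩
    · rw [pow_succ]
      nlinarith [pow_pos hp.pos n]
    · rintro t ⟨ht, hft⟩
      have hdm := Nat.mod_add_div t (p ^ n)
      have hmod : t % p ^ n = t₀ := by
        refine huniq _ ⟨Nat.mod_lt _ (pow_pos hp.pos n), ?_⟩
        exact pow_dvd_mod_of_expansion hf ((pow_dvd_pow _ (by omega)).trans hft)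
      rw [hmod] at hdm
      rw [← hdm] at hft ⊢
      have hk' := (hstep _).1 hft
      have hlt : t / p ^ n < p := Nat.div_lt_of_lt_mul (by rwa [← pow_succ])
      have hdiff : (p : ℤ) ∣ (((t / p ^ n : ℕ) : ℤ) - k) * c := by
        have := dvd_sub hk' hk
        rwa [add_sub_add_left_eq_sub, ← sub_mul] at this
      have hd := ((Nat.prime_iff_prime_int.1 hp).dvd_or_dvd hdiff).resolve_right hc
      have : t / p ^ n ≡ k [MOD p] := by
        rw [Nat.ModEq.comm, Nat.modEq_iff_dvd]
        exact hd
      rw [this.eq_of_lt_of_lt hlt hkp]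

theorem exists_coprime_not_dvd_pow_sub_one (p : ℕ) [Fact p.Prime] :
    ∃ a : ℕ, a.Coprime p ∧ ∀ m : ℕ, ¬ p - 1 ∣ m → ¬ (p : ℤ) ∣ (a : ℤ) ^ m - 1 := by
  obtain ⟨g, hg⟩ := IsCyclic.exists_ofOrder_eq_natCard (α := (ZMod p)ˣ)
  rw [Nat.card_eq_fintype_card, ZMod.card_units] at hg
  refine ⟨(g : ZMod p).val, ZMod.val_coe_unit_coprime g, fun m hm h => hm ?_⟩
  rw [← hg, orderOf_dvd_iff_pow_eq_one]
  rw [← ZMod.intCast_zmod_eq_zero_iff_dvd] at h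
  push_cast at h
  rw [ZMod.natCast_zmod_val, sub_eq_zero] at h
  exact Units.ext (by simpa using h)

theorem irregularDelta_eq_zero_of_powDvd {l : ℕ}
    (h : PowDvd p 2 (dividedBernoulli (l + (p - 1)) - dividedBernoulli l)) :
    irregularDelta p l = 0 := by
  have hp : p.Prime := Fact.out
  have hp0 : (p : ℚ) ≠ 0 := mod_cast hp.ne_zero
  obtain ⟨z, hz, hz'⟩ := h
  have h1 : PowDvd p 1 ((dividedBernoulli (l + (p - 1)) - dividedBernoulli l) / p) :=
    ⟨z, hz, by rw [hz']; field_simp⟩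
  rw [powDvd_iff_dvd_num one_ne_zero, pow_one, ← ZMod.intCast_zmod_eq_zero_iff_dvd] at h1
  simp [irregularDelta, Nat.totient_prime hp, h1]

/-- Along a residue class modulo `p - 1`, divisibility of `B_m / m` by powers of `p` is governed by
an integer-valued function with constant `p`-adic slope, invertible if `Δ ≠ 0`. -/
theorem exists_expansion_of_dividedBernoulli (hp5 : 5 ≤ p) {l N : ℕ} (hN : 2 ≤ N) (hl : Even l)
    (hl2 : 2 ≤ l) (hlp : l < p - 1) :
    ∃ (f : ℕ → ℤ) (c : ℤ),
      (∀ n t k : ℕ, (p : ℤ) ^ (n + 2) ∣ f (t + p ^ n * k) - f t - p ^ (n + 1) * k * c) ∧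
      (∀ n t : ℕ, n ≠ 0 → n ≤ N →
        ((p : ℤ) ^ n ∣ (dividedBernoulli (l + t * (p - 1))).num ↔ (p : ℤ) ^ n ∣ f t)) ∧
      ((p : ℤ) ∣ (dividedBernoulli l).num → irregularDelta p l ≠ 0 → ¬ (p : ℤ) ∣ c) := by
  have hp : p.Prime := Fact.out
  obtain ⟨a, ha, ha'⟩ := exists_coprime_not_dvd_pow_sub_one p
  have hap : ∀ t, ¬ (p : ℤ) ∣ (a : ℤ) ^ (l + t * (p - 1)) - 1 := fun t => ha' _ fun h => by
    rw [Nat.dvd_add_left (dvd_mul_left _ _)] at h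
    exact absurd (Nat.le_of_dvd (by omega) h) (by omega)
  have heven : ∀ t, Even (l + t * (p - 1)) := fun t =>
    hl.add ((hp.even_sub_one (by omega)).mul_left t)
  obtain ⟨c, hc⟩ := exists_voronoiSum_expansion hp5 N ha (show 1 ≤ l by omega)
  have hiff : ∀ n t : ℕ, n ≠ 0 → n ≤ N →
      ((p : ℤ) ^ n ∣ (dividedBernoulli (l + t * (p - 1))).num ↔
        (p : ℤ) ^ n ∣ voronoiSum p N a (l + t * (p - 1))) := fun n t hn hnN =>
    pow_dvd_num_dividedBernoulli_iff hp5 hN hn hnN (heven t) (by omega) ha (hap t)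
  refine ⟨fun t => voronoiSum p N a (l + t * (p - 1)), c, hc, hiff, fun hB hΔ hpc => hΔ ?_⟩
  apply irregularDelta_eq_zero_of_powDvd
  have hf01 : (p : ℤ) ^ 2 ∣
      voronoiSum p N a (l + 1 * (p - 1)) - voronoiSum p N a (l + 0 * (p - 1)) := by
    have h := hc 0 0 1
    obtain ⟨d, rfl⟩ := hpc
    have h2 : (p : ℤ) ^ (0 + 2) ∣ p ^ (0 + 1) * (1 : ℕ) * (p * d) := ⟨d, by push_cast; ring⟩
    have := dvd_add h h2
    simpa using this
  have hB0 : (p : ℤ) ^ 1 ∣ (dividedBernoulli (l + 0 * (p - 1))).num := by simpa using hB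
  have hB1 : (p : ℤ) ^ 1 ∣ (dividedBernoulli (l + 1 * (p - 1))).num := by
    rw [hiff 1 1 one_ne_zero (by omega)]
    rw [hiff 1 0 one_ne_zero (by omega)] at hB0
    have := dvd_add ((pow_dvd_pow _ (by norm_num)).trans hf01) hB0
    simpa using this
  have hG0 := (powDvd_sub_voronoiSum hp5 hN (heven 0) (by omega) ha).mono hN
  have hG1 := (powDvd_sub_voronoiSum hp5 hN (heven 1) (by omega) ha).mono hN
  rw [← powDvd_intCast_iff] at hf01
  rw [← powDvd_iff_dvd_num one_ne_zero] at hB0 hB1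
  obtain ⟨w₀, hw₀, hB0⟩ := hB0
  obtain ⟨w₁, hw₁, hB1⟩ := hB1
  have hfermat : (p : ℤ) ∣ (a : ℤ) ^ (p - 1) - 1 :=
    (Int.ModEq.pow_card_sub_one_eq_one hp (Nat.isCoprime_iff_coprime.2 ha)).symm.dvd
  obtain ⟨q, hq⟩ := hfermat
  have hqQ : (a : ℚ) ^ (p - 1) = 1 + p * q := by
    have : ((a : ℚ) ^ (p - 1) - 1) = p * q := by exact_mod_cast hq
    linarith
  have h0 := hap 0
  rw [zero_mul, add_zero] at hG0 hf01 hB0 h0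
  rw [one_mul] at hG1 hf01 hB1
  rw [← PowDvd.intCast_mul_iff h0]
  have hG := (hG1.sub hG0).add hf01
  push_cast at hG ⊢
  have hrest : PowDvd p 2
      ((p : ℚ) ^ (l + (p - 1) - 1) * ((a : ℚ) ^ (l + (p - 1)) - 1) * (p * w₁) -
        (p : ℚ) ^ (l - 1) * ((a : ℚ) ^ l - 1) * (p * w₀) - (a : ℚ) ^ l * (p * q) * (p * w₁)) := by
    obtain ⟨j, rfl⟩ := Nat.exists_eq_add_of_le' hl2
    refine ⟨((p ^ (j + (p - 1)) : ℕ) : ℚ) * ((a : ℚ) ^ (j + 2 + (p - 1)) - 1) * w₁ -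
      ((p ^ j : ℕ) : ℚ) * ((a : ℚ) ^ (j + 2) - 1) * w₀ - (a : ℚ) ^ (j + 2) * q * w₁, ?_, ?_⟩
    · have haR : ∀ i, (a : ℚ) ^ i - 1 ∈ pIntegers p := fun i =>
        sub_mem (pow_mem (natCast_mem _ _) _) (one_mem _)
      exact sub_mem (sub_mem (mul_mem (mul_mem (natCast_mem _ _) (haR _)) hw₁)
        (mul_mem (mul_mem (natCast_mem _ _) (haR _)) hw₀))
        (mul_mem (mul_mem (pow_mem (natCast_mem _ _) _) (intCast_mem _ _)) hw₁)
    · rw [show j + 2 + (p - 1) - 1 = j + (p - 1) + 1 by omega, show j + 2 - 1 = j + 1 by omega]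
      push_cast
      ring
  convert hG.add hrest using 1
  rw [pow_one] at hB0 hB1
  rw [hB0, hB1]
  rw [pow_add (a : ℚ), hqQ]
  ring

end KummerCongruences

section IrregularPairs

variable {p l : ℕ}

theorem correspondsTo_succ_iff (hp : p.Prime) (hp2 : p ≠ 2) (hl : Even l) (hl2 : 2 ≤ l)
    (hlp : l < p - 1) (n l' : ℕ) :
    CorrespondsTo p l (n + 1) l' ↔ ∃ t < p ^ n, l' = l + t * (p - 1) ∧
      (p : ℤ) ^ (n + 1) ∣ (dividedBernoulli (l + t * (p - 1))).num := by
  have htot : Nat.totient (p ^ (n + 1)) = p ^ n * (p - 1) := by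
    rw [Nat.totient_prime_pow_succ hp]
  constructor
  · rintro ⟨⟨-, -, hdvd, h2, hlt, -⟩, hmod⟩
    have hlt : l' < Nat.totient (p ^ (n + 1)) := hlt
    have hle : l ≤ l' := by
      have h1 : l' % (p - 1) = l := Eq.trans hmod (Nat.mod_eq_of_lt hlp)
      rw [← h1]
      exact Nat.mod_le _ _
    obtain ⟨t, ht⟩ := (Nat.modEq_iff_dvd' hle).1 hmod.symm
    have hl' : l' = l + t * (p - 1) := by rw [mul_comm t, ← ht]; omega
    refine ⟨t, ?_, hl', hl' ▸ hdvd⟩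
    rw [htot] at hlt
    exact lt_of_mul_lt_mul_right (show t * (p - 1) < p ^ n * (p - 1) by omega) (Nat.zero_le _)
  · rintro ⟨t, ht, rfl, hdvd⟩
    refine ⟨⟨hp, hp2, hdvd, Nat.le_add_right_of_le hl2, ?_,
      hl.add ((hp.even_sub_one hp2).mul_left t)⟩, ?_⟩
    · change l + t * (p - 1) < Nat.totient (p ^ (n + 1))
      rw [htot]
      nlinarith
    · simp [Nat.ModEq]

theorem IsIrregularPair.five_le (h : IsIrregularPair p l) : 5 ≤ p := by
  obtain ⟨-, -, -, h2, h3, -⟩ := h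
  omega

theorem IsIrregularPair.dvd_num_dividedBernoulli (h : IsIrregularPair p l) :
    (p : ℤ) ∣ (dividedBernoulli l).num := by
  obtain ⟨hp, -, -, h2, h3, h⟩ := h
  have : Fact p.Prime := ⟨hp⟩
  rw [← pow_one (p : ℤ), ← powDvd_iff_dvd_num one_ne_zero] at h ⊢
  have hl : ¬ p ∣ l := fun hd => absurd (Nat.le_of_dvd (by omega) hd) (by omega)
  have := h.mul_left (inv_natCast_mem_pIntegers hl)
  rwa [inv_mul_eq_div] at this

/-- If `Δ_{(p,l)} ≠ 0`, there is exactly one irregular pair of each order corresponding to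
`(p, l)`. -/
theorem IsIrregularPair.existsUnique_correspondsTo (h : IsIrregularPair p l)
    (hΔ : irregularDelta p l ≠ 0) (n : ℕ) : ∃! l' : ℕ, CorrespondsTo p l (n + 1) l' := by
  have hp5 := h.five_le
  have hB := h.dvd_num_dividedBernoulli
  obtain ⟨hp, hp2, hl, hl2, hlp, -⟩ := h
  have : Fact p.Prime := ⟨hp⟩
  obtain ⟨f, c, hf, hiff, hc⟩ := exists_expansion_of_dividedBernoulli hp5
    (N := n + 2) (by omega) hl hl2 (by omega)
  have h0 : (p : ℤ) ∣ f 0 := by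
    rw [← pow_one (p : ℤ), ← hiff 1 0 one_ne_zero (by omega)]
    simpa using hB
  obtain ⟨t, ⟨ht, htd⟩, huniq⟩ := existsUnique_pow_dvd_of_expansion hf (hc hB hΔ) h0 n
  simp only [correspondsTo_succ_iff hp hp2 hl hl2 (show l < p - 1 by omega)]
  refine ⟨l + t * (p - 1), ⟨t, ht, rfl, (hiff _ _ (by omega) (by omega)).2 htd⟩, ?_⟩
  rintro _ ⟨t', ht', rfl, hd⟩
  rw [huniq t' ⟨ht', (hiff _ _ (by omega) (by omega)).1 hd⟩]

/-- **Kummer's congruences**: reduction modulo `φ(p ^ n)` yields an irregular pair of order `n`. -/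
theorem IsIrregularPair.exists_correspondsTo_modEq (h : IsIrregularPair p l) (n : ℕ) {m : ℕ}
    (hm : l ≤ m) (hml : m ≡ l [MOD p - 1]) (hdvd : (p : ℤ) ^ (n + 1) ∣ (dividedBernoulli m).num) :
    ∃ l' : ℕ, CorrespondsTo p l (n + 1) l' ∧ l' ≡ m [MOD p ^ n] := by
  have hp5 := h.five_le
  obtain ⟨hp, hp2, hl, hl2, hlp, -⟩ := h
  have : Fact p.Prime := ⟨hp⟩
  obtain ⟨f, c, hf, hiff, -⟩ := exists_expansion_of_dividedBernoulli hp5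
    (N := n + 2) (by omega) hl hl2 (by omega)
  obtain ⟨t, ht⟩ := (Nat.modEq_iff_dvd' hm).1 hml.symm
  obtain rfl : m = l + t * (p - 1) := by rw [mul_comm t, ← ht]; omega
  rw [hiff _ _ (by omega) (by omega)] at hdvd
  simp only [correspondsTo_succ_iff hp hp2 hl hl2 (show l < p - 1 by omega)]
  refine ⟨_, ⟨t % p ^ n, Nat.mod_lt _ (pow_pos hp.pos n), rfl, ?_⟩,
    ((Nat.mod_modEq t (p ^ n)).mul_right _).add_left l⟩
  rw [hiff _ _ (by omega) (by omega)]
  exact pow_dvd_mod_of_expansion hf hdvd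

theorem eq_of_sum_mul_pow_eq {p n : ℕ} {s t : Fin n → ℕ} (hs : ∀ i, s i < p) (ht : ∀ i, t i < p)
    (h : ∑ i : Fin n, s i * p ^ (i : ℕ) = ∑ i : Fin n, t i * p ^ (i : ℕ)) : s = t := by
  have h1 := finFunctionFinEquiv.injective
    (a₁ := fun i => (⟨s i, hs i⟩ : Fin p)) (a₂ := fun i => ⟨t i, ht i⟩) (Fin.ext (by
      simpa [finFunctionFinEquiv_apply] using h))
  funext i
  simpa using congrFun h1 i

theorem digitValue_succ (hp : p.Prime) {n : ℕ} (s : Fin (n + 1) → ℕ) :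
    digitValue p s = s 0 + (p - 1) * ∑ i : Fin n, s i.succ * p ^ (i : ℕ) := by
  rw [digitValue, Fin.sum_univ_succ, Finset.mul_sum]
  congr 1
  · simp
  · refine Finset.sum_congr rfl fun i _ => ?_
    rw [Fin.val_succ, Nat.totient_prime_pow_succ hp]
    ring

theorem eq_of_digitValue_eq (hp : p.Prime) {n : ℕ} {s t : Fin (n + 1) → ℕ}
    (hs : ∀ i, s i < p) (ht : ∀ i, t i < p) (hs0 : s 0 < p - 1) (ht0 : t 0 < p - 1)
    (h : digitValue p s = digitValue p t) : s = t := by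
  rw [digitValue_succ hp, digitValue_succ hp] at h
  have h0 : s 0 = t 0 := by
    have := congrArg (· % (p - 1)) h
    simpa [Nat.mod_eq_of_lt hs0, Nat.mod_eq_of_lt ht0] using this
  rw [h0] at h
  have h1 := Nat.eq_of_mul_eq_mul_left (by omega) (Nat.add_left_cancel h)
  have h2 := eq_of_sum_mul_pow_eq (fun i => hs (Fin.succ i)) (fun i => ht (Fin.succ i)) h1
  funext i
  refine Fin.cases h0 (fun j => congrFun h2 j) i

theorem digitValue_specialDigits (hp : p.Prime) (hl : 1 ≤ l) (n : ℕ) :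
    digitValue p (specialDigits l (n + 1)) = 1 + (l - 1) * p ^ n := by
  rw [digitValue_succ hp]
  obtain ⟨q, rfl⟩ := Nat.exists_eq_add_of_le' hp.one_lt.le
  obtain ⟨k, rfl⟩ := Nat.exists_eq_add_of_le' hl
  have h := geom_sum_mul_add q n
  rw [← Fin.sum_univ_eq_sum_range (fun i => (q + 1) ^ i)] at h
  simp only [specialDigits, Fin.val_zero, Fin.val_succ, Nat.add_sub_cancel, if_true,
    Nat.succ_ne_zero, if_false]
  rw [← Finset.mul_sum, ← h]
  ring

theorem digitValue_eq_of_modEq (hp : p.Prime) {n l' : ℕ} (hl : 1 ≤ l) (hlp : l < p - 1)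
    (h : CorrespondsTo p l (n + 1) l') (h1 : l' ≡ 1 [MOD p ^ n]) :
    digitValue p (specialDigits l (n + 1)) = l' := by
  obtain ⟨⟨-, -, -, -, hlt, -⟩, hmod⟩ := h
  have hlt : l' < Nat.totient (p ^ (n + 1)) := hlt
  rw [Nat.totient_prime_pow_succ hp] at hlt
  rw [digitValue_specialDigits hp hl]
  have hcop : Nat.Coprime (p ^ n) (p - 1) :=
    Nat.Coprime.pow_left n
      ((Nat.coprime_self_sub_right hp.one_lt.le).2 (Nat.coprime_one_right p))
  refine Nat.ModEq.eq_of_lt_of_lt (m := p ^ n * (p - 1)) ?_ ?_ hlt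
  · rw [← Nat.modEq_and_modEq_iff_modEq_mul hcop]
    refine ⟨?_, ?_⟩
    · refine Nat.ModEq.trans ?_ h1.symm
      simp [Nat.ModEq]
    · refine Nat.ModEq.trans ?_ hmod.symm
      have hp1 : p ^ n ≡ 1 [MOD p - 1] := by
        have : p ≡ 1 [MOD p - 1] := ((Nat.modEq_iff_dvd' hp.one_lt.le).2 dvd_rfl).symm
        simpa using this.pow n
      have := (hp1.mul_left (l - 1)).add_left 1
      rwa [mul_one, Nat.add_sub_cancel' hl] at this
  · have hpos : 1 ≤ p ^ n := pow_pos hp.pos n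
    calc 1 + (l - 1) * p ^ n ≤ l * p ^ n := by
          obtain ⟨k, rfl⟩ := Nat.exists_eq_add_of_le' hl
          rw [Nat.add_sub_cancel, add_mul, one_mul]
          omega
      _ < p ^ n * (p - 1) := by
          rw [mul_comm]
          exact Nat.mul_lt_mul_of_pos_left hlp hpos

theorem dvd_of_mem_solutionSet (hp : p.Prime) {u lu m : ℕ} (hm : 2 ≤ m)
    (h : m ∈ solutionSet p u lu) :
    (p : ℤ) ^ u ∣ (dividedBernoulli m).num ∧ m ≡ 1 [MOD p ^ u] := by
  obtain ⟨-, h⟩ := h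
  have hm0 : (m : ℚ) ≠ 0 := mod_cast (by omega : m ≠ 0)
  obtain ⟨k, rfl⟩ := Nat.exists_eq_add_of_le' (show 1 ≤ m by omega)
  have hk0 : (k : ℚ) ≠ 0 := mod_cast (by omega : k ≠ 0)
  have hB : bernoulli (k + 1) / (((k + 1 : ℕ) : ℚ) * (((k + 1 : ℕ) : ℚ) - 1)) =
      dividedBernoulli (k + 1) / k := by
    rw [dividedBernoulli, div_div]
    push_cast
    ring_nf
  rw [hB] at h
  change ((dividedBernoulli (k + 1)).num : ℚ) / _ = _ at h
  set x := dividedBernoulli (k + 1) with hx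
  set y := x / k with hy
  have hp0 : (p : ℚ) ^ u ≠ 0 := pow_ne_zero _ (mod_cast hp.ne_zero)
  have hy0 : (y.num : ℚ) ≠ 0 := fun h0 => by
    rw [h0, div_zero] at h
    exact hp0 h.symm
  rw [div_eq_iff hy0] at h
  have hnum : x.num = (p : ℤ) ^ u * y.num := by exact_mod_cast h
  have hdvd : (p : ℤ) ^ u ∣ x.num := ⟨_, hnum⟩
  refine ⟨hdvd, ?_⟩
  have hxy : x = y * k := by rw [hy, div_mul_cancel₀ _ hk0]
  have hxd : (x.den : ℚ) ≠ 0 := mod_cast x.den_ne_zero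
  have hyd : (y.den : ℚ) ≠ 0 := mod_cast y.den_ne_zero
  have hcross : p ^ u * y.den = x.den * k := by
    rw [← Rat.num_div_den x, ← Rat.num_div_den y, h] at hxy
    field_simp at hxy
    exact_mod_cast hxy
  have hcop : Nat.Coprime (p ^ u) x.den := by
    refine Nat.Coprime.of_dvd_left ?_ x.reduced
    rw [← Int.natCast_dvd]
    exact_mod_cast hdvd
  have := hcop.dvd_of_dvd_mul_left (Dvd.intro _ hcross)
  rw [Nat.ModEq.comm, Nat.modEq_iff_dvd' (by omega)]
  simpa using this

end IrregularPairs

theorem mainTheorem4 (p l r : ℕ) (hpl : IsIrregularPair p l) (hΔ : irregularDelta p l ≠ 0)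
    (hr : 2 ≤ r) (s : Fin r → ℕ) (hs : (p, s) ∈ PsiHatIrr r)
    (hcorr : CorrespondsTo p l r (digitValue p s)) (hne : s ≠ specialDigits l r)
    (u : ℕ) (hu : r ≤ u) :
    (∃! lu : ℕ, CorrespondsTo p l u lu) ∧
      ∀ lu : ℕ, CorrespondsTo p l u lu → ¬ ∃ a : ℕ, IsLeast (solutionSet p u lu) a := by
  obtain ⟨v, rfl⟩ := Nat.exists_eq_add_of_le' (show 1 ≤ u by omega)
  obtain ⟨n, rfl⟩ := Nat.exists_eq_add_of_le' (show 1 ≤ r by omega)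
  refine ⟨hpl.existsUnique_correspondsTo hΔ v, ?_⟩
  rintro lu hlu ⟨m, hm, -⟩
  have ⟨hp, hp2, hl, hl2, hlp, _⟩ := hpl
  apply hne
  obtain ⟨-, hslt, hs0⟩ := hs
  have hml : l ≤ m ∧ m ≡ l [MOD p - 1] := by
    obtain ⟨⟨k, rfl⟩, -⟩ := hm
    obtain ⟨t, -, rfl, -⟩ := (correspondsTo_succ_iff hp hp2 hl hl2 (by omega) v lu).1 hlu
    refine ⟨by rw [add_assoc]; exact Nat.le_add_right _ _, ?_⟩
    rw [Nat.totient_prime_pow_succ hp]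
    simp [Nat.ModEq, ← mul_assoc]
  obtain ⟨hdvd, hm1⟩ := dvd_of_mem_solutionSet hp (hl2.trans hml.1) hm
  obtain ⟨l', hl', hl'm⟩ := hpl.exists_correspondsTo_modEq n hml.1 hml.2
    ((pow_dvd_pow _ hu).trans hdvd)
  have hl'1 : l' ≡ 1 [MOD p ^ n] := hl'm.trans (hm1.of_dvd (pow_dvd_pow _ (by omega)))
  have hspec := digitValue_eq_of_modEq hp (by omega) (by omega) hl' hl'1
  refine eq_of_digitValue_eq hp hslt (fun i => ?_) ?_ ?_ ?_
  · rw [specialDigits]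
    split_ifs <;> omega
  · have := hs0 0 rfl
    simp only at this
    omega
  · simp only [specialDigits, Fin.val_zero, if_true]
    omega
  · rw [hspec]
    exact (hpl.existsUnique_correspondsTo hΔ n).unique hcorr hl'
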